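/- Let $L$ be a permutation group on a finite set $\Omega$. If $L$ is graph-restrictive, then $L$ is semiprimitive. Here all graphs are finite and simple. For a graph $\Gamma$ and a subgroup $G\le\mathrm{Aut}(\Gamma)$, write $G_v$ for the stabiliser in $G$ of a vertex $v$, $G_{uv}=G_u\cap G_v$, and $G_v^{\Gamma(v)}$ for the permutation group that $G_v$ induces on the neighbourhood $\Gamma(v)$ of $v$. The pair $(\Gamma,G)$ is *locally-$L$* if $\Gamma$ is connected, $G$ is transitive on the vertices of $\Gamma$, and $L$ is permutation isomorphic to $G_v^{\Gamma(v)}$ for a vertex $v$ of $\Gamma$ (equivalently, for every vertex $v$). The group $L$ is *graph-restrictive* if it is transitive on $\Omega$ and there is a constant $c(L)$ such that $|G_{uv}|\le c(L)$ for every locally-$L$ pair $(\Gamma,G)$ and every arc $(u,v)$ of $\Gamma$, that is, every ordered pair of adjacent vertices. The group $L$ is *semiprimitive* if it is transitive on $\Omega$ and each of its normal subgroups is transitive or semiregular on $\Omega$, where a subgroup is semiregular if only its identity element fixes a point. -/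

import Mathlib

/-- An action of `M` on `Ω` is semiregular if every point stabiliser is trivial. -/
def IsSemiregular (M Ω : Type*) [Group M] [MulAction M Ω] : Prop :=
  ∀ ω : Ω, MulAction.stabilizer M ω = ⊥

/-- A permutation group is semiprimitive if it is transitive and each of its normal subgroups is
transitive or semiregular. -/
def IsSemiprimitive {Ω : Type*} (L : Subgroup (Equiv.Perm Ω)) : Prop :=
  MulAction.IsPretransitive L Ω ∧
    ∀ K : Subgroup L, K.Normal → MulAction.IsPretransitive K Ω ∨ IsSemiregular K Ω

/-- Two permutation groups are permutation isomorphic if there are a bijection of the sets and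
an isomorphism of the groups that intertwine the two actions. -/
def PermIsomorphic {Ω Ω' : Type*} (L : Subgroup (Equiv.Perm Ω))
    (L' : Subgroup (Equiv.Perm Ω')) : Prop :=
  ∃ (e : Ω ≃ Ω') (φ : L ≃* L'), ∀ (l : L) (ω : Ω), e (l • ω) = φ l • e ω

/-- `Γ` is `G`-vertex-transitive, for `G` a subgroup of `Aut(Γ)`. -/
def IsVertexTransitive {V : Type*} (Γ : SimpleGraph V) (G : Subgroup (Γ ≃g Γ)) : Prop :=
  MulAction.IsPretransitive G V

/-- The permutation group that the stabiliser `G_v` induces on the neighbourhood `Γ(v)`. -/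
def localGroup {V : Type*} (Γ : SimpleGraph V) (G : Subgroup (Γ ≃g Γ)) (v : V) :
    Subgroup (Equiv.Perm (Γ.neighborSet v)) where
  carrier := {σ | ∃ g ∈ G, g v = v ∧ ∀ w : Γ.neighborSet v, (σ w : V) = g w}
  one_mem' := ⟨1, G.one_mem, rfl, fun _ => rfl⟩
  mul_mem' := by
    rintro σ τ ⟨g, hg, hgv, hσ⟩ ⟨h, hh, hhv, hτ⟩
    refine ⟨g * h, G.mul_mem hg hh, ?_, fun w => ?_⟩
    · rw [RelIso.mul_apply, hhv, hgv]
    · rw [Equiv.Perm.mul_apply, hσ, hτ, RelIso.mul_apply]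
  inv_mem' := by
    rintro σ ⟨g, hg, hgv, hσ⟩
    refine ⟨g⁻¹, G.inv_mem hg, ?_, fun w => ?_⟩
    · exact g.injective (by rw [RelIso.apply_inv_self, hgv])
    · exact g.injective (by rw [RelIso.apply_inv_self, ← hσ, Equiv.Perm.inv_def, Equiv.apply_symm_apply])

/-- The pair `(Γ, G)` is locally-`L`. -/
def IsLocally {V Ω : Type*} (Γ : SimpleGraph V) (G : Subgroup (Γ ≃g Γ))
    (L : Subgroup (Equiv.Perm Ω)) : Prop :=
  Γ.Connected ∧ IsVertexTransitive Γ G ∧ ∃ v : V, PermIsomorphic L (localGroup Γ G v)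

/-- A permutation group `L` is graph-restrictive if it is transitive and some constant bounds the
orders of the arc-stabilisers `G_{uv}` of all locally-`L` pairs `(Γ, G)` with `Γ` a finite graph. -/
def IsGraphRestrictive {Ω : Type*} (L : Subgroup (Equiv.Perm Ω)) : Prop :=
  MulAction.IsPretransitive L Ω ∧
    ∃ c : ℕ, ∀ (V : Type) [Finite V] (Γ : SimpleGraph V) (G : Subgroup (Γ ≃g Γ)),
      IsLocally Γ G L → ∀ u v : V, Γ.Adj u v →
        Nat.card (MulAction.stabilizer G u ⊓ MulAction.stabilizer G v : Subgroup G) ≤ c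

open MulAction Equiv

theorem permIsomorphic_of_map_eq {Ω Ω' : Type*} {L : Subgroup (Perm Ω)} {L' : Subgroup (Perm Ω')}
    (e : Ω ≃ Ω') (h : L.map e.permCongrHom.toMonoidHom = L') : PermIsomorphic L L' := by
  subst h
  refine ⟨e, L.equivMapOfInjective _ e.permCongrHom.injective, fun l ω => ?_⟩
  change e ((l : Perm Ω) ω) = e.permCongr (l : Perm Ω) (e ω)
  simp

section OrbitalGraph

variable {H V : Type*} [Group H] [MulAction H V]

/-- The graph whose arcs are the translates of the pair `(v, t • v)`, for an involution `t`. -/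
def orbitalGraph (v : V) (t : H) (ht : t * t = 1) (hv : t • v ≠ v) : SimpleGraph V where
  Adj x y := ∃ h : H, h • v = x ∧ (h * t) • v = y
  symm := ⟨by
    rintro _ _ ⟨h, rfl, rfl⟩
    exact ⟨h * t, rfl, by rw [mul_assoc, ht, mul_one]⟩⟩
  loopless := ⟨by
    rintro _ ⟨h, rfl, hh⟩
    rw [mul_smul] at hh
    exact hv (smul_left_cancel h hh)⟩

variable (v : V) (t : H) (ht : t * t = 1) (hv : t • v ≠ v)

/-- The action of `H` on its orbital graph. -/
def orbitalGraphHom : H →* (orbitalGraph v t ht hv ≃g orbitalGraph v t ht hv) where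
  toFun g :=
    { toEquiv := MulAction.toPerm g
      map_rel_iff' := by
        intro x y
        constructor
        · rintro ⟨h, hx, hy⟩
          refine ⟨g⁻¹ * h, ?_, ?_⟩
          · rw [mul_smul, hx]; exact inv_smul_smul g x
          · rw [mul_assoc, mul_smul, hy]; exact inv_smul_smul g y
        · rintro ⟨h, rfl, rfl⟩
          exact ⟨g * h, mul_smul _ _ _, by rw [mul_assoc, mul_smul]; rfl⟩ }
  map_one' := by ext x; exact one_smul H x
  map_mul' g h := by ext x; exact mul_smul g h x

theorem orbitalGraph_connected [IsPretransitive H V]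
    (hgen : Subgroup.closure ((stabilizer H v : Set H) ∪ {t}) = ⊤) :
    (orbitalGraph v t ht hv).Connected := by
  have key : ∀ h : H, (orbitalGraph v t ht hv).Reachable v (h • v) := by
    intro h
    have hh : h ∈ Subgroup.closure ((stabilizer H v : Set H) ∪ {t}) := hgen ▸ Subgroup.mem_top h
    have htt : t⁻¹ = t := inv_eq_of_mul_eq_one_right ht
    have step : ∀ x : H, (orbitalGraph v t ht hv).Adj (x • v) ((x * t) • v) :=
      fun x => ⟨x, rfl, rfl⟩
    induction hh using Subgroup.closure_induction_right with
    | one => rw [one_smul]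
    | mul_right x _ y hy ih =>
      rcases hy with hy | hy
      · rwa [mul_smul, mem_stabilizer_iff.1 hy]
      · rw [Set.mem_singleton_iff.1 hy]
        exact ih.trans (step x).reachable
    | mul_inv_cancel x _ y hy ih =>
      rcases hy with hy | hy
      · rwa [mul_smul, mem_stabilizer_iff.1 ((stabilizer H v).inv_mem hy)]
      · rw [Set.mem_singleton_iff.1 hy, htt]
        exact ih.trans (step x).reachable
  have : Nonempty V := ⟨v⟩
  refine ⟨fun x y => ?_⟩
  obtain ⟨g, rfl⟩ := exists_smul_eq H v x
  obtain ⟨h, rfl⟩ := exists_smul_eq H v y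
  exact (key g).symm.trans (key h)

theorem permIsomorphic_localGroup {Ω : Type*} {L : Subgroup (Perm Ω)} [IsPretransitive L Ω]
    (ω : Ω) (ρ : stabilizer H v →* L) (hρ : Function.Surjective ρ)
    (hstab : ∀ a : stabilizer H v, (a : H) • t • v = t • v ↔ ρ a • ω = ω) :
    PermIsomorphic L
      (localGroup (orbitalGraph v t ht hv) (orbitalGraphHom v t ht hv).range v) := by
  have hsurj : ∀ α : Ω, ∃ a : stabilizer H v, ρ a • ω = α := by
    intro α
    obtain ⟨l, rfl⟩ := exists_smul_eq L ω α
    obtain ⟨a, rfl⟩ := hρ l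
    exact ⟨a, rfl⟩
  choose s hs using hsurj
  have heq : ∀ a b : stabilizer H v,
      (a : H) • t • v = (b : H) • t • v ↔ ρ a • ω = ρ b • ω := by
    intro a b
    have := hstab (b⁻¹ * a)
    rw [map_mul, map_inv, mul_smul, inv_smul_eq_iff, Subgroup.coe_mul, Subgroup.coe_inv, mul_smul,
      inv_smul_eq_iff] at this
    exact this
  have hadj : ∀ α, (orbitalGraph v t ht hv).Adj v ((s α : H) • t • v) :=
    fun α => ⟨s α, (s α).2, mul_smul _ _ _⟩
  let e₀ : Ω → (orbitalGraph v t ht hv).neighborSet v := fun α => ⟨(s α : H) • t • v, hadj α⟩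
  have he₀ : ∀ a : stabilizer H v, (e₀ (ρ a • ω) : V) = (a : H) • t • v :=
    fun a => (heq _ _).2 (hs _)
  have hbij : Function.Bijective e₀ := by
    constructor
    · intro α β h
      have := (heq _ _).1 (congrArg Subtype.val h)
      rwa [hs, hs] at this
    · rintro ⟨x, h, hx, hy⟩
      exact ⟨ρ ⟨h, hx⟩ • ω, Subtype.ext ((he₀ ⟨h, hx⟩).trans (by rw [← mul_smul]; exact hy))⟩
  let e : Ω ≃ (orbitalGraph v t ht hv).neighborSet v := Equiv.ofBijective e₀ hbij
  have hact : ∀ (a : stabilizer H v) (α : Ω), (e (ρ a • α) : V) = (a : H) • (e α : V) := by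
    intro a α
    change (e₀ (ρ a • α) : V) = (a : H) • ((s α : H) • t • v)
    conv_lhs => rw [← hs α, ← mul_smul, ← map_mul, he₀]
    rw [Subgroup.coe_mul, mul_smul]
  refine permIsomorphic_of_map_eq e ?_
  ext σ
  constructor
  · rintro ⟨l, hl, rfl⟩
    obtain ⟨a, ha⟩ := hρ ⟨l, hl⟩
    refine ⟨orbitalGraphHom v t ht hv a, ⟨_, rfl⟩, a.2, fun w => ?_⟩
    have := hact a (e.symm w)
    rw [ha, e.apply_symm_apply] at this
    exact this
  · rintro ⟨_, ⟨a, rfl⟩, hav, hσ⟩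
    refine ⟨ρ ⟨a, hav⟩, (ρ ⟨a, hav⟩).2, ?_⟩
    ext w
    have := hact ⟨a, hav⟩ (e.symm w)
    rw [e.apply_symm_apply] at this
    rw [hσ]
    exact this

theorem isLocally_orbitalGraph {Ω : Type*} {L : Subgroup (Perm Ω)} [IsPretransitive L Ω]
    [IsPretransitive H V]
    (hgen : Subgroup.closure ((stabilizer H v : Set H) ∪ {t}) = ⊤)
    (ω : Ω) (ρ : stabilizer H v →* L) (hρ : Function.Surjective ρ)
    (hstab : ∀ a : stabilizer H v, (a : H) • t • v = t • v ↔ ρ a • ω = ω) :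
    IsLocally (orbitalGraph v t ht hv) (orbitalGraphHom v t ht hv).range L := by
  refine ⟨orbitalGraph_connected v t ht hv hgen, ⟨fun x y => ?_⟩, v,
    permIsomorphic_localGroup v t ht hv ω ρ hρ hstab⟩
  obtain ⟨g, hg⟩ := exists_smul_eq H x y
  exact ⟨⟨_, g, rfl⟩, hg⟩

end OrbitalGraph

/-- A finite group generated by a subgroup `A` and an involution `t` yields a locally-`L` pair with
vertex stabiliser `A`, when `A` maps onto `L` so that `A ∩ A ^ t` is the preimage of a point
stabiliser and no nontrivial subgroup of `A` is normal. -/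
theorem exists_isLocally_of_involution {X Ω J : Type*} [Group X] [Finite X]
    {L : Subgroup (Perm Ω)} [IsPretransitive L Ω] (A : Subgroup X) (t : X) (ht : t * t = 1)
    (htA : t ∉ A) (hgen : Subgroup.closure ((A : Set X) ∪ {t}) = ⊤) (ω : Ω) (ρ : A →* L)
    (hρ : Function.Surjective ρ) (hstab : ∀ a : A, t * a * t ∈ A ↔ ρ a • ω = ω)
    (hcore : A.normalCore = ⊥) (s : J → A) (hs : Function.Injective s)
    (hsω : ∀ j, ρ (s j) • ω = ω) :
    ∃ (V : Type) (_ : Finite V) (Γ : SimpleGraph V) (G : Subgroup (Γ ≃g Γ)),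
      IsLocally Γ G L ∧ ∃ u v, Γ.Adj u v ∧
        Nat.card J ≤ Nat.card (stabilizer G u ⊓ stabilizer G v : Subgroup G) := by
  obtain ⟨n, ⟨e⟩⟩ := Finite.exists_equiv_fin (X ⧸ A)
  let _ : MulAction X (Fin n) := e.symm.mulAction X
  have hsmul : ∀ (x : X) (q : X ⧸ A), x • e q = e (x • q) := by
    intro x q
    change e (x • e.symm (e q)) = _
    rw [e.symm_apply_apply]
  have : IsPretransitive X (Fin n) := ⟨fun i j => by
    obtain ⟨x, hx⟩ := exists_smul_eq X (e.symm i) (e.symm j)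
    exact ⟨x, by rw [← e.apply_symm_apply i, hsmul, hx, e.apply_symm_apply]⟩⟩
  have htt : t⁻¹ = t := inv_eq_of_mul_eq_one_right ht
  let v : Fin n := e ((1 : X) : X ⧸ A)
  have hmk : ∀ x : X, x • v = e (x : X ⧸ A) := fun x => by
    rw [hsmul, MulAction.Quotient.smul_coe, smul_eq_mul, mul_one]
  have heq : ∀ x y : X, x • v = y • v ↔ x⁻¹ * y ∈ A := fun x y => by
    rw [hmk, hmk, e.apply_eq_iff_eq, QuotientGroup.eq]
  have hstabA : stabilizer X v = A := by
    ext x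
    rw [mem_stabilizer_iff]
    conv_lhs => rw [← one_smul X v, smul_smul, heq, mul_one, mul_one]
    exact inv_mem_iff
  have hv : t • v ≠ v := fun h => htA (hstabA ▸ mem_stabilizer_iff.2 h)
  have hfix : ∀ x : X, x • t • v = t • v ↔ t * x * t ∈ A := fun x => by
    rw [smul_smul, eq_comm, heq, htt, mul_assoc]
  let ι : stabilizer X v ≃* A := MulEquiv.subgroupCongr hstabA
  refine ⟨Fin n, inferInstance, orbitalGraph v t ht hv, (orbitalGraphHom v t ht hv).range,
    isLocally_orbitalGraph v t ht hv (by rw [hstabA, hgen]) ω (ρ.comp ι.toMonoidHom)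
      (hρ.comp ι.surjective) (fun a => (hfix a).trans (hstab (ι a))), v, t • v,
    ⟨1, one_smul _ _, by rw [one_mul]⟩, ?_⟩
  have hinj : Function.Injective (orbitalGraphHom v t ht hv) := by
    rw [injective_iff_map_eq_one]
    intro x hx
    have hxv : ∀ w : Fin n, x • w = w := fun w => DFunLike.congr_fun hx w
    have hmemA : x ∈ A.normalCore := by
      intro y
      rw [← hstabA, mem_stabilizer_iff, mul_smul, mul_smul, hxv, smul_inv_smul]
    rwa [hcore, Subgroup.mem_bot] at hmemA
  have : Finite (orbitalGraphHom v t ht hv).range :=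
    Finite.of_surjective _ (orbitalGraphHom v t ht hv).rangeRestrict_surjective
  have hmem : ∀ j, (orbitalGraphHom v t ht hv).rangeRestrict (s j) ∈
      stabilizer (orbitalGraphHom v t ht hv).range v ⊓
        stabilizer (orbitalGraphHom v t ht hv).range (t • v) := by
    refine fun j => ⟨?_, (hfix _).2 ((hstab _).2 (hsω j))⟩
    have : (s j : X) ∈ stabilizer X v := by rw [hstabA]; exact (s j).2
    exact this
  refine Nat.card_le_card_of_injective (fun j => ⟨_, hmem j⟩) fun i j hij => ?_
  exact hs (Subtype.ext (hinj (congrArg Subtype.val (congrArg Subtype.val hij))))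

section Amalgam

variable {Ω B : Type*}

/-- The permutation of `Option (B × J)` induced by a permutation of `B`. -/
def optionProdPerm (J : Type*) : Perm B →* Perm (Option (B × J)) where
  toFun π := optionCongr (π.prodCongr (Equiv.refl J))
  map_one' := by ext1 y; rcases y with _ | ⟨b, j⟩ <;> rfl
  map_mul' π π' := by ext1 y; rcases y with _ | ⟨b, j⟩ <;> rfl

@[simp]
theorem optionProdPerm_none {J : Type*} (π : Perm B) : optionProdPerm J π none = none := rfl

@[simp]
theorem optionProdPerm_some {J : Type*} (π : Perm B) (b : B) (j : J) :
    optionProdPerm J π (some (b, j)) = some (π b, j) := rfl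

/-- The permutations of `Option (B × J) × Ω` that act as an element of `L` on each fibre over
`Option (B × J)`, such that these elements all induce the same permutation of `B` along `β`, this
permutation also being induced on the base, and such that the fibre over `(b, j)` has the marked
point `r b`. -/
def fibredGroup (L : Subgroup (Perm Ω)) (β : Ω → B) (r : B → Ω) (J : Type*) :
    Subgroup (Perm (Option (B × J) × Ω)) where
  carrier := {g | ∃ (π : Perm B) (f : Option (B × J) → Perm Ω), (∀ y, f y ∈ L) ∧
    (∀ y α, β (f y α) = π (β α)) ∧ (∀ b j, f (some (b, j)) (r b) = r (π b)) ∧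
    ∀ y α, g (y, α) = (optionProdPerm J π y, f y α)}
  one_mem' := ⟨1, fun _ => 1, fun _ => L.one_mem, fun _ _ => rfl, fun _ _ => rfl,
    fun y α => by rw [map_one]; rfl⟩
  mul_mem' := by
    rintro _ _ ⟨π, f, hL, hβ, hr, hg⟩ ⟨π', f', hL', hβ', hr', hg'⟩
    refine ⟨π * π', fun y => f (optionProdPerm J π' y) * f' y,
      fun y => L.mul_mem (hL _) (hL' _), fun y α => ?_, fun b j => ?_, fun y α => ?_⟩
    · rw [Perm.mul_apply, hβ, hβ', Perm.mul_apply]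
    · rw [Perm.mul_apply, hr', optionProdPerm_some, hr, Perm.mul_apply]
    · rw [Perm.mul_apply, hg', hg, map_mul, Perm.mul_apply, Perm.mul_apply]
  inv_mem' := by
    rintro g ⟨π, f, hL, hβ, hr, hg⟩
    refine ⟨π⁻¹, fun y => (f (optionProdPerm J π⁻¹ y))⁻¹, fun y => L.inv_mem (hL _),
      fun y α => ?_, fun b j => ?_, fun y α => ?_⟩
    · rw [Perm.eq_inv_iff_eq, ← hβ (optionProdPerm J π⁻¹ y), ← Perm.mul_apply, mul_inv_cancel, Perm.one_apply]
    · rw [Perm.inv_eq_iff_eq, optionProdPerm_some, hr, ← Perm.mul_apply, mul_inv_cancel, Perm.one_apply]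
    · rw [Perm.inv_eq_iff_eq, hg, ← Perm.mul_apply, ← Perm.mul_apply, ← map_mul, mul_inv_cancel,
        mul_inv_cancel, map_one, Perm.one_apply, Perm.one_apply]

/-- The action of `fibredGroup` on the fibre over `none`. -/
theorem exists_hom_fibredGroup (L : Subgroup (Perm Ω)) (β : Ω → B) (r : B → Ω) (J : Type*) : ∃ ρ : fibredGroup L β r J →* L,
    ∀ (a : fibredGroup L β r J) α, (a : Perm (Option (B × J) × Ω)) (none, α) = (none, (ρ a : Perm Ω) α) := by
  have h : ∀ a : fibredGroup L β r J, ∃ l : L, ∀ α,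
      (a : Perm (Option (B × J) × Ω)) (none, α) = (none, (l : Perm Ω) α) := by
    rintro ⟨a, π, f, hL, -, -, ha⟩
    exact ⟨⟨f none, hL none⟩, fun α => ha none α⟩
  choose ρ hρ using h
  refine ⟨MonoidHom.mk' ρ fun a b => ?_, hρ⟩
  ext α
  have := hρ (a * b) α
  rw [Subgroup.coe_mul, Perm.mul_apply, hρ, hρ] at this
  exact (congrArg Prod.snd this).symm

variable {L : Subgroup (Perm Ω)} {β : Ω → B} {r : B → Ω} {J : Type*}

theorem exists_mem_fibredGroup (hr : ∀ b, β (r b) = b)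
    (hK : ∀ α α', β α = β α' → ∃ k ∈ L, (∀ γ, β (k γ) = β γ) ∧ k α = α')
    {l : Perm Ω} (hl : l ∈ L) {π : Perm B} (hπ : ∀ α, β (l α) = π (β α)) :
    ∃ a ∈ fibredGroup L β r J, ∃ f : Option (B × J) → Perm Ω, f none = l ∧
      ∀ y α, a (y, α) = (optionProdPerm J π y, f y α) := by
  have h : ∀ b, β (l (r b)) = β (r (π b)) := fun b => by rw [hπ, hr, hr]
  choose k hkL hkβ hk using fun b => hK _ _ (h b)
  let f : Option (B × J) → Perm Ω := fun y => y.elim l fun p => k p.1 * l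
  refine ⟨Equiv.prodShear (optionProdPerm J π) f, ⟨π, f, ?_, ?_, fun b j => hk b, fun _ _ => rfl⟩,
    f, rfl, fun _ _ => rfl⟩
  · rintro (_ | ⟨b, j⟩)
    · exact hl
    · exact L.mul_mem (hkL b) hl
  · rintro (_ | ⟨b, j⟩) α
    · exact hπ α
    · exact (hkβ b _).trans (hπ α)

variable [DecidableEq B] (b₁ : B) [DecidableEq J]

/-- The element of `Perm (Option (B × J) × Ω)` acting as `k` on the fibre over `some (b₁, j)` and
trivially elsewhere. -/
def singlePerm (k : Perm Ω) (j : J) : Perm (Option (B × J) × Ω) :=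
  Equiv.prodShear (Equiv.refl _) fun y => if y = some (b₁, j) then k else 1

theorem singlePerm_apply_self (k : Perm Ω) (j : J) (α : Ω) :
    singlePerm b₁ k j (some (b₁, j), α) = (some (b₁, j), k α) := by
  simp [singlePerm]

theorem singlePerm_apply_of_ne (k : Perm Ω) {j : J} {y : Option (B × J)} (hy : y ≠ some (b₁, j))
    (α : Ω) : singlePerm b₁ k j (y, α) = (y, α) := by
  simp [singlePerm, hy]

theorem singlePerm_injective {k : Perm Ω} (hk : k ≠ 1) :
    Function.Injective (singlePerm b₁ k : J → _) := by
  intro i j hij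
  by_contra hne
  apply hk
  ext1 α
  have h1 := singlePerm_apply_self b₁ k i α
  rw [hij, singlePerm_apply_of_ne b₁ k (by simpa using hne)] at h1
  exact (congrArg Prod.snd h1).symm

theorem singlePerm_mem {k : Perm Ω} (hk : k ∈ L) (hkβ : ∀ α, β (k α) = β α)
    (hkr : k (r b₁) = r b₁) (j : J) : singlePerm b₁ k j ∈ fibredGroup L β r J := by
  refine ⟨1, fun y => if y = some (b₁, j) then k else 1, fun y => ?_, fun y α => ?_,
    fun b i => ?_, fun y α => by rw [map_one]; rfl⟩
  · dsimp only
    split_ifs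
    exacts [hk, L.one_mem]
  · dsimp only
    split_ifs
    exacts [hkβ α, rfl]
  · dsimp only
    split_ifs with h
    · obtain ⟨rfl, -⟩ : b = b₁ ∧ i = j := by simpa using h
      exact hkr
    · rfl

variable [CommRing J]

/-- The involution of `Option (B × J)` exchanging `none` and `(b₁, 0)`, acting on the other points
`(b₁, j)` as negation and on the points `(b, j)` with `b ≠ b₁` as `j ↦ 1 - j`. -/
def foldFun : Option (B × J) → Option (B × J)
  | none => some (b₁, 0)
  | some (b, j) => if b = b₁ then (if j = 0 then none else some (b, -j)) else some (b, 1 - j)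

@[simp]
theorem foldFun_none : foldFun b₁ (none : Option (B × J)) = some (b₁, 0) := rfl

@[simp]
theorem foldFun_zero : foldFun b₁ (some (b₁, (0 : J))) = none := by simp [foldFun]

theorem foldFun_neg {j : J} (hj : j ≠ 0) : foldFun b₁ (some (b₁, j)) = some (b₁, -j) := by
  simp [foldFun, hj]

theorem foldFun_sub {b : B} (hb : b ≠ b₁) (j : J) :
    foldFun b₁ (some (b, j)) = some (b, 1 - j) := by
  simp [foldFun, hb]

theorem foldFun_involutive : Function.Involutive (foldFun b₁ : Option (B × J) → _) := by
  rintro (_ | ⟨b, j⟩)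
  · simp
  · by_cases hb : b = b₁
    · subst hb
      by_cases hj : j = 0
      · subst hj; simp
      · rw [foldFun_neg b hj, foldFun_neg b (neg_ne_zero.2 hj), neg_neg]
    · rw [foldFun_sub b₁ hb, foldFun_sub b₁ hb, sub_sub_cancel]

theorem foldFun_optionProdPerm {π : Perm B} (hπ : π b₁ = b₁) (y : Option (B × J)) :
    foldFun b₁ (optionProdPerm J π y) = optionProdPerm J π (foldFun b₁ y) := by
  rcases y with _ | ⟨b, j⟩
  · simp [hπ]
  · by_cases hb : b = b₁
    · subst hb
      by_cases hj : j = 0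
      · subst hj; simp [hπ]
      · simp [hπ, foldFun_neg b hj]
    · have : π b ≠ b₁ := fun h => hb (π.injective (h.trans hπ.symm))
      simp [foldFun_sub b₁ hb, foldFun_sub b₁ this]

variable (Ω) in
/-- The involution `foldFun` acting on the first factor of `Option (B × J) × Ω`. -/
def foldPerm (J : Type*) [DecidableEq J] [CommRing J] : Perm (Option (B × J) × Ω) :=
  ((foldFun_involutive b₁).toPerm).prodCongr (Equiv.refl Ω)

@[simp]
theorem foldPerm_apply (y : Option (B × J)) (α : Ω) :
    foldPerm Ω b₁ J (y, α) = (foldFun b₁ y, α) := rfl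

theorem foldPerm_mul_self : foldPerm Ω b₁ J * foldPerm Ω b₁ J = 1 := by
  ext1 ⟨y, α⟩
  rw [Perm.mul_apply, foldPerm_apply, foldPerm_apply, foldFun_involutive, Perm.one_apply]

theorem foldPerm_notMem [Nonempty Ω] : foldPerm Ω b₁ J ∉ fibredGroup L β r J := by
  rintro ⟨π, f, -, -, -, hg⟩
  have := congrArg Prod.fst (hg none (Classical.arbitrary Ω))
  simp at this

/-- A conjugate of an element of `fibredGroup` by `foldPerm` lies in `fibredGroup` exactly when the
element fixes the marked point of the block `b₁` in the fibre over `none`. -/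
theorem foldPerm_conj_mem_iff (hr : ∀ b, β (r b) = b) {a : Perm (Option (B × J) × Ω)}
    (ha : a ∈ fibredGroup L β r J) :
    foldPerm Ω b₁ J * a * foldPerm Ω b₁ J ∈ fibredGroup L β r J ↔
      a (none, r b₁) = (none, r b₁) := by
  obtain ⟨π, f, hL, hβ, hf, ha⟩ := ha
  constructor
  · rintro ⟨π', f', -, -, hf', ha'⟩
    have hπ' : π' b₁ = b₁ := by
      have h2 := congrArg Prod.fst (ha' (some (b₁, 0)) (r b₁))
      simp only [Perm.mul_apply, foldPerm_apply, foldFun_none, ha, optionProdPerm_some,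
        foldFun_zero, optionProdPerm_none, Option.some.injEq, Prod.mk.injEq, and_true] at h2
      exact h2.symm
    have h := congrArg Prod.snd (ha' (some (b₁, 0)) (r b₁))
    simp only [Perm.mul_apply, foldPerm_apply, foldFun_zero, ha, hf', hπ'] at h
    rw [ha, h, optionProdPerm_none]
  · intro hfix
    have hfix' : f none (r b₁) = r b₁ := by
      rw [ha] at hfix
      exact congrArg Prod.snd hfix
    have hπ : π b₁ = b₁ := by
      have := hβ none (r b₁)
      rwa [hfix', hr, eq_comm] at this
    refine ⟨π, fun y => f (foldFun b₁ y), fun _ => hL _, fun _ _ => hβ _ _, fun b j => ?_,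
      fun y α => ?_⟩
    · change f (foldFun b₁ (some (b, j))) (r b) = r (π b)
      by_cases hb : b = b₁
      · subst hb
        by_cases hj : j = 0
        · subst hj; rw [foldFun_zero, hfix', hπ]
        · rw [foldFun_neg b hj, hf]
      · rw [foldFun_sub b₁ hb, hf]
    · rw [Perm.mul_apply, Perm.mul_apply, foldPerm_apply, ha, foldPerm_apply,
        ← foldFun_optionProdPerm b₁ hπ, foldFun_involutive]

theorem eq_one_of_forall_conj_mem_fibredGroup [IsPretransitive L Ω] (hr : ∀ b, β (r b) = b)
    (hβ : ∀ l ∈ L, ∃ π : Perm B, ∀ α, β (l α) = π (β α))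
    (hK : ∀ α α', β α = β α' → ∃ k ∈ L, (∀ γ, β (k γ) = β γ) ∧ k α = α')
    {b₂ : B} (hb : b₂ ≠ b₁) (hJ : Function.Surjective (Nat.cast : ℕ → J))
    {x : Perm (Option (B × J) × Ω)}
    (hx : ∀ h ∈ Subgroup.closure
      ((fibredGroup L β r J : Set (Perm (Option (B × J) × Ω))) ∪ {foldPerm Ω b₁ J}),
      h * x * h⁻¹ ∈ fibredGroup L β r J) : x = 1 := by
  set A := fibredGroup L β r J
  set t := foldPerm Ω b₁ J with ht
  set H := Subgroup.closure ((A : Set (Perm (Option (B × J) × Ω))) ∪ {t})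
  have hAH : ∀ a ∈ A, a ∈ H := fun a ha => Subgroup.subset_closure (Or.inl ha)
  have htH : t ∈ H := Subgroup.subset_closure (Or.inr rfl)
  have htt : t⁻¹ = t := inv_eq_of_mul_eq_one_right (foldPerm_mul_self b₁)
  let S : Option (B × J) → Prop := fun y => ∀ h ∈ H, ∀ α, (h * x * h⁻¹) (y, α) = (y, α)
  have hS : ∀ h ∈ H, ∀ y y', (∀ α', ∃ α, h (y, α) = (y', α')) → S y → S y' := by
    intro h hh y y' hyy hy g hg α'
    obtain ⟨α, hα⟩ := hyy α'
    have := congrArg h (hy (h⁻¹ * g) (H.mul_mem (H.inv_mem hh) hg) α)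
    rw [hα, ← Perm.mul_apply] at this
    rw [← hα, ← Perm.mul_apply, hα, ← this]
    congr 1
    group
  have hnone : S none := by
    intro h hh α
    obtain ⟨⟨l, hl⟩, rfl⟩ := exists_smul_eq L (r b₁) α
    obtain ⟨π, hπ⟩ := hβ l hl
    obtain ⟨a, haA, f, hf, ha⟩ := exists_mem_fibredGroup (J := J) hr hK hl hπ
    have h1 := hx (a⁻¹ * h) (H.mul_mem (H.inv_mem (hAH a haA)) hh)
    have h2 := hx (t * (a⁻¹ * h))
      (H.mul_mem htH (H.mul_mem (H.inv_mem (hAH a haA)) hh))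
    have h3 := (foldPerm_conj_mem_iff b₁ hr h1).1 (by
      rw [mul_inv_rev t, htt] at h2
      convert h2 using 1
      simp only [ht, mul_assoc])
    have h4 := congrArg a h3
    rw [← Perm.mul_apply, ha, hf] at h4
    have h5 : a * (a⁻¹ * h * x * (a⁻¹ * h)⁻¹) = h * x * h⁻¹ * a := by group
    rw [h5, Perm.mul_apply, ha, hf] at h4
    exact h4
  have hfold : ∀ y, S y → S (foldFun b₁ y) := fun y =>
    hS t htH _ _ fun α => ⟨α, rfl⟩
  have hmove : ∀ b b' j, S (some (b, j)) → S (some (b', j)) := by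
    intro b b' j
    obtain ⟨⟨l, hl⟩, hlb⟩ := exists_smul_eq L (r b) (r b')
    obtain ⟨π, hπ⟩ := hβ l hl
    obtain ⟨a, haA, f, hf, ha⟩ := exists_mem_fibredGroup (J := J) hr hK hl hπ
    have hb' : π b = b' := by
      rw [← hr b, ← hπ, ← hr b', ← hlb]
      rfl
    refine hS a (hAH a haA) _ _ fun α => ⟨(f (some (b, j))).symm α, ?_⟩
    rw [ha, optionProdPerm_some, hb', Equiv.apply_symm_apply]
  have hsucc : ∀ j, S (some (b₁, j)) → S (some (b₁, j + 1)) := by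
    intro j hj
    have hneg : S (some (b₁, -j)) := by
      by_cases h0 : j = 0
      · rwa [h0, neg_zero, ← h0]
      · rw [← foldFun_neg b₁ h0]; exact hfold _ hj
    have := hfold _ (hmove _ b₂ _ hneg)
    rw [foldFun_sub b₁ hb, sub_neg_eq_add, add_comm] at this
    exact hmove _ _ _ this
  have hnat : ∀ n : ℕ, S (some (b₁, (n : J))) := by
    intro n
    induction n with
    | zero => rw [Nat.cast_zero, ← foldFun_none]; exact hfold _ hnone
    | succ n ih => rw [Nat.cast_succ]; exact hsucc _ ih
  have hall : ∀ y, S y := by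
    rintro (_ | ⟨b, j⟩)
    · exact hnone
    · obtain ⟨n, rfl⟩ := hJ j
      exact hmove _ _ _ (hnat n)
  ext1 ⟨y, α⟩
  simpa using hall y 1 H.one_mem α

theorem exists_isLocally_of_block_system [Finite Ω] [Finite B] [Finite J] [IsPretransitive L Ω]
    (hr : ∀ b, β (r b) = b) (hβ : ∀ l ∈ L, ∃ π : Perm B, ∀ α, β (l α) = π (β α))
    (hK : ∀ α α', β α = β α' → ∃ k ∈ L, (∀ γ, β (k γ) = β γ) ∧ k α = α')
    {b₂ : B} (hb : b₂ ≠ b₁) (hJ : Function.Surjective (Nat.cast : ℕ → J)) {k : Perm Ω}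
    (hk : k ∈ L) (hk1 : k ≠ 1) (hkβ : ∀ α, β (k α) = β α) (hkr : k (r b₁) = r b₁) :
    ∃ (V : Type) (_ : Finite V) (Γ : SimpleGraph V) (G : Subgroup (Γ ≃g Γ)),
      IsLocally Γ G L ∧ ∃ u v, Γ.Adj u v ∧
        Nat.card J ≤ Nat.card (stabilizer G u ⊓ stabilizer G v : Subgroup G) := by
  have : Nonempty Ω := ⟨r b₁⟩
  obtain ⟨ρ, hρ⟩ := exists_hom_fibredGroup L β r J
  have hsurj : Function.Surjective ρ := by
    rintro ⟨l, hl⟩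
    obtain ⟨π, hπ⟩ := hβ l hl
    obtain ⟨a, haA, f, hf, ha⟩ := exists_mem_fibredGroup (J := J) hr hK hl hπ
    refine ⟨⟨a, haA⟩, ?_⟩
    ext α
    have := hρ ⟨a, haA⟩ α
    rw [ha, hf] at this
    exact (congrArg Prod.snd this).symm
  have hfix : ∀ a, ρ a • r b₁ = r b₁ ↔
      (a : Perm (Option (B × J) × Ω)) (none, r b₁) = (none, r b₁) := by
    intro a
    rw [hρ, Prod.mk.injEq]
    exact (and_iff_right rfl).symm
  let H := Subgroup.closure
    ((fibredGroup L β r J : Set (Perm (Option (B × J) × Ω))) ∪ {foldPerm Ω b₁ J})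
  have hAH : fibredGroup L β r J ≤ H := fun a ha => Subgroup.subset_closure (Or.inl ha)
  let t : H := ⟨foldPerm Ω b₁ J, Subgroup.subset_closure (Or.inr rfl)⟩
  let ι := Subgroup.subgroupOfEquivOfLe hAH
  refine exists_isLocally_of_involution ((fibredGroup L β r J).subgroupOf H) t
    (Subtype.ext (foldPerm_mul_self b₁)) (fun h => foldPerm_notMem b₁ h) ?_ (r b₁)
    (ρ.comp ι.toMonoidHom) (hsurj.comp ι.surjective) (fun a => ?_) ?_
    (fun j => ι.symm ⟨_, singlePerm_mem b₁ hk hkβ hkr j⟩) (fun i j hij => ?_) (fun j => ?_)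
  · convert Subgroup.closure_closure_coe_preimage using 2
    ext x
    simp only [Set.mem_union, Set.mem_singleton_iff, Set.mem_preimage, SetLike.mem_coe,
      Subgroup.mem_subgroupOf, Subtype.ext_iff, t]
  · exact (foldPerm_conj_mem_iff b₁ hr (ι a).2).trans (hfix _).symm
  · rw [eq_bot_iff]
    intro x hx
    exact Subtype.ext (eq_one_of_forall_conj_mem_fibredGroup b₁ hr hβ hK hb hJ
      fun h hh => hx ⟨h, hh⟩)
  · exact singlePerm_injective b₁ hk1 (congrArg Subtype.val (ι.symm.injective hij))
  · change ρ (ι (ι.symm _)) • r b₁ = r b₁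
    rw [MulEquiv.apply_symm_apply, hfix]
    exact singlePerm_apply_of_ne b₁ k (by simp) _

end Amalgam

theorem theorem1p1 {Ω : Type*} [Finite Ω] (L : Subgroup (Equiv.Perm Ω))
    (hL : IsGraphRestrictive L) : IsSemiprimitive L := by
  classical
  obtain ⟨htrans, c, hc⟩ := hL
  refine ⟨htrans, fun K hKn => ?_⟩
  by_contra! hcon
  obtain ⟨hnt, hns⟩ := hcon
  obtain ⟨ω, k, hkω, hk1⟩ : ∃ ω : Ω, ∃ k : K, k • ω = ω ∧ k ≠ 1 := by
    unfold IsSemiregular at hns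
    push Not at hns
    obtain ⟨ω, hω⟩ := hns
    obtain ⟨⟨k, hk⟩, hk1⟩ := Subgroup.ne_bot_iff_exists_ne_one.1 hω
    exact ⟨ω, k, hk, fun h => hk1 (Subtype.ext h)⟩
  let B := orbitRel.Quotient K Ω
  let β : Ω → B := Quotient.mk _
  have hβeq : ∀ α α', β α = β α' ↔ ∃ k : K, k • α' = α := fun α α' =>
    Quotient.eq.trans (orbitRel_apply.trans mem_orbit_iff)
  let r : B → Ω := Function.update Quotient.out (β ω) ω
  have hr : ∀ b, β (r b) = b := by
    intro b
    by_cases hb : b = β ω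
    · subst hb; simp [r]
    · simp only [r, Function.update_of_ne hb]
      exact Quotient.out_eq b
  have hrω : r (β ω) = ω := by simp [r]
  have hKβ : ∀ (k : K) α, β (k • α) = β α := fun k α => (hβeq _ _).2 ⟨k, rfl⟩
  have hβ : ∀ l ∈ L, ∃ π : Perm B, ∀ α, β (l α) = π (β α) := by
    intro l hl
    refine ⟨Quotient.congr l fun α α' => ?_, fun α => rfl⟩
    rw [← Quotient.eq, ← Quotient.eq]
    refine ((hβeq _ _).trans ?_).trans (hβeq _ _).symm
    constructor
    · rintro ⟨k, rfl⟩
      refine ⟨⟨⟨l, hl⟩ * k * ⟨l, hl⟩⁻¹, hKn.conj_mem _ k.2 _⟩, ?_⟩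
      change l ((k : Perm Ω) (l⁻¹ (l _))) = l ((k : Perm Ω) _)
      rw [← Perm.mul_apply l⁻¹, inv_mul_cancel, Perm.one_apply]
    · rintro ⟨k, hk⟩
      refine ⟨⟨⟨l, hl⟩⁻¹ * k * ⟨l, hl⟩, hKn.conj_mem' _ k.2 _⟩, ?_⟩
      change l⁻¹ ((k : Perm Ω) (l _)) = _
      exact Perm.inv_eq_iff_eq.2 hk
  have hK : ∀ α α', β α = β α' → ∃ k ∈ L, (∀ γ, β (k γ) = β γ) ∧ k α = α' := by
    intro α α' h
    obtain ⟨k, hk⟩ := (hβeq _ _).1 h.symm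
    exact ⟨k, k.1.2, fun γ => hKβ k γ, hk⟩
  obtain ⟨b₂, hb⟩ : ∃ b₂, b₂ ≠ β ω := by
    by_contra! hall
    refine hnt ⟨fun α α' => ?_⟩
    exact (hβeq _ _).1 ((hall (β α')).trans (hall (β α)).symm)
  obtain ⟨V, hV, Γ, G, hloc, u, v, huv, hcard⟩ := exists_isLocally_of_block_system
    (J := ZMod (c + 1)) (β ω) hr hβ hK hb (ZMod.natCast_zmod_surjective) k.1.2
    (fun h => hk1 (Subtype.ext (Subtype.ext h))) (fun α => hKβ k α) (by rw [hrω]; exact hkω)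
  have := hcard.trans (hc V Γ G hloc u v huv)
  rw [Nat.card_zmod] at this
  omega
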